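/- Let $G$ be a compact connected Lie group with Lie algebra $\mathfrak g$ of left-invariant vector fields, and let $X_1,\dots,X_m\in\mathfrak g$ generate $\mathfrak g$ as a Lie algebra. A trajectory of the system $$x'=\sum_{k=1}^m u_k X_k(x)\qquad(\ast)$$ is a tuple $(x,u_1,\dots,u_m)$ where $u_1,\dots,u_m:\mathbb R\to\mathbb R$ are $C^\infty$ and $x:\mathbb R\to G$ is an integral curve of the time-dependent vector field $(t,y)\mapsto\sum_k u_k(t)X_k(y)$. It is periodic if, for some $T>0$, the functions $x,u_1,\dots,u_m$ are all $T$-periodic, and regular if $\operatorname{span}\{\operatorname{Ad}(x(t))X_k : t\in\mathbb R,\ 1\le k\le m\}=\mathfrak g$. Let $(x_r,u_1^r,\dots,u_m^r)$ be a regular periodic trajectory of $(\ast)$. Put $V(w)=\operatorname{tr}\operatorname{Ad}(w)$ for $w\in G$, and for $t\in\mathbb R$, $w\in G$ put $$a_k(t,w)=\mathrm dV\big((\operatorname{Ad}(x_r(t))X_k)(w)\big),\qquad W(t,w)=\sum_{k=1}^m a_k(t,w)\,(\operatorname{Ad}(x_r(t))X_k)(w)\in T_wG .$$ Let $\mathcal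 C_W=\{w\in G : W(t,w)=0\ \text{for all } t\in\mathbb R\}$. Then for all $x,y\in G$: 1. if $x\in\mathcal C_W$ then $yxy^{-1}\in\mathcal C_W$; 2. if $xy\in\mathcal C_W$ then $yx\in\mathcal C_W$; 3. if $x\in\mathcal C_W$ then $x^{-1}\in\mathcal C_W$. Moreover, if $G$ is semisimple (that is, $\mathfrak g$ has no nonzero solvable ideal) and $\mathcal C_W$ is a subgroup of $G$, then $\mathcal C_W$ is finite. -/

import Mathlib

open scoped Manifold ContDiff

noncomputable section

/-- A smooth real Lie group is of class `C^3`, the smoothness under which Mathlib builds the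
Lie bracket on its Lie algebra. -/
instance smoothLieGroup_minSmoothness
    {E : Type*} [NormedAddCommGroup E] [NormedSpace ℝ E] {H : Type*} [TopologicalSpace H]
    {I : ModelWithCorners ℝ E H} {G : Type*} [TopologicalSpace G] [ChartedSpace H G] [Group G]
    [LieGroup I ∞ G] : LieGroup I (minSmoothness ℝ 3) G :=
  LieGroup.of_le (n := ∞) (by
    rw [minSmoothness_of_isRCLikeNormedField]
    exact ENat.LEInfty.out)

namespace LieTracking

variable {E : Type*} [NormedAddCommGroup E] [NormedSpace ℝ E] {H : Type*} [TopologicalSpace H]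
  (I : ModelWithCorners ℝ E H)
  {G : Type*} [TopologicalSpace G] [ChartedSpace H G] [Group G]

/-- The adjoint representation: `Ad I x : 𝔤 → 𝔤` is the differential at the identity of the
conjugation `y ↦ x * y * x⁻¹`, where `𝔤 = T₁G`. (The differential takes its values in the tangent
space at `x * 1 * x⁻¹ = 1`.) -/
def Ad (x : G) : GroupLieAlgebra I G →ₗ[ℝ] GroupLieAlgebra I G :=
  (mfderiv I I (fun y : G => x * y * x⁻¹) (1 : G)).toLinearMap

/-- The Lyapunov-like function `V(x) = tr Ad(x)`. -/
def V (x : G) : ℝ := LinearMap.trace ℝ (GroupLieAlgebra I G) (Ad I x)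

/-- The time-dependent vector field `(t, x) ↦ ∑ k, u_k(t) X_k(x)` of the left-invariant driftless
system with controls `u`. Left-invariant vector fields are given by their values at `1`. -/
def controlField {m : ℕ} (X : Fin m → GroupLieAlgebra I G) (u : Fin m → ℝ → ℝ)
    (t : ℝ) (x : G) : TangentSpace I x :=
  ∑ k, u k t • (mulInvariantVectorField (X k) x : TangentSpace I x)

/-- `(x, u_1, …, u_m)` is a (smooth) trajectory of `x' = ∑ k, u_k X_k(x)`: the controls are smooth
functions on `ℝ` and `x : ℝ → G` is an integral curve of the associated time-dependent field. -/
structure IsTrajectory {m : ℕ} (X : Fin m → GroupLieAlgebra I G) (x : ℝ → G)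
    (u : Fin m → ℝ → ℝ) : Prop where
  smooth_controls : ∀ k, ContDiff ℝ ∞ (u k)
  integralCurve : ∀ t : ℝ, HasMFDerivAt 𝓘(ℝ, ℝ) I x t
    ((1 : ℝ →L[ℝ] ℝ).smulRight (controlField I X u t (x t)))

/-- A trajectory is `T`-periodic if `T > 0` and the curve and all the controls are `T`-periodic. -/
structure IsPeriodicTrajectory {m : ℕ} (X : Fin m → GroupLieAlgebra I G) (x : ℝ → G)
    (u : Fin m → ℝ → ℝ) (T : ℝ) : Prop extends IsTrajectory I X x u where
  period_pos : 0 < T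
  periodic_curve : Function.Periodic x T
  periodic_controls : ∀ k, Function.Periodic (u k) T

/-- Regularity of a trajectory with underlying curve `x`: the vectors `Ad(x(t)) X_k` span `𝔤`. -/
def IsRegularTrajectory {m : ℕ} (X : Fin m → GroupLieAlgebra I G) (x : ℝ → G) : Prop :=
  Submodule.span ℝ {Y : GroupLieAlgebra I G | ∃ (t : ℝ) (k : Fin m), Y = Ad I (x t) (X k)} = ⊤

/-- The functions `a_k(t, w) = dV (Ad(x_r(t)) X_k (w))`. -/
def auxCoeff {m : ℕ} (X : Fin m → GroupLieAlgebra I G) (xr : ℝ → G)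
    (k : Fin m) (t : ℝ) (w : G) : ℝ :=
  mfderiv I 𝓘(ℝ, ℝ) (V I : G → ℝ) w (mulInvariantVectorField (Ad I (xr t) (X k)) w)

/-- The auxiliary vector field `W(t, w) = ∑ k, a_k(t, w) Ad(x_r(t)) X_k (w)`. -/
def auxField {m : ℕ} (X : Fin m → GroupLieAlgebra I G) (xr : ℝ → G)
    (t : ℝ) (w : G) : TangentSpace I w :=
  ∑ k, auxCoeff I X xr k t w •
    (mulInvariantVectorField (Ad I (xr t) (X k)) w : TangentSpace I w)

/-- The set `C_W` of critical points of the auxiliary vector field. -/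
def criticalSet {m : ℕ} (X : Fin m → GroupLieAlgebra I G) (xr : ℝ → G) : Set G :=
  {w : G | ∀ t : ℝ, auxField I X xr t w = 0}

end LieTracking

end

open Filter Topology MeasureTheory

theorem hasFDerivAt_adjoint_of_local_mul {E : Type*} [NormedAddCommGroup E] [NormedSpace ℝ E]
    {m c : E × E → E} {e : E} (hm : ContDiffAt ℝ 2 m (e, e)) (hc : ContDiffAt ℝ 2 c (e, e))
    (h_one : ∀ᶠ a in 𝓝 e, m (a, e) = a) (one_h : ∀ᶠ a in 𝓝 e, m (e, a) = a)
    (hmc : ∀ᶠ p in 𝓝 (e, e), m (c p, p.1) = m p) (hce : ∀ᶠ a in 𝓝 e, c (a, e) = e) :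
    ∃ D : E →L[ℝ] E →L[ℝ] E,
      HasFDerivAt (fun a => fderiv ℝ (fun b => c (a, b)) e) D e ∧
      ∀ y z : E, D z y = fderiv ℝ (fun a => fderiv ℝ (fun b => m (a, b)) e y) e z
        - fderiv ℝ (fun a => fderiv ℝ (fun b => m (a, b)) e z) e y := by
  have evd : ∀ {f : E × E → E}, ContDiffAt ℝ 2 f (e, e) →
      ∀ᶠ p in 𝓝 (e, e), DifferentiableAt ℝ f p := fun hf =>
    (hf.eventually (by simp)).mono fun p hp => hp.differentiableAt (by simp)
  have hl : Tendsto (fun a : E => (a, e)) (𝓝 e) (𝓝 (e, e)) := by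
    have : Continuous (fun a : E => (a, e)) := by fun_prop
    exact this.tendsto e
  have hr : Tendsto (fun a : E => (e, a)) (𝓝 e) (𝓝 (e, e)) := by
    have : Continuous (fun a : E => (e, a)) := by fun_prop
    exact this.tendsto e
  have part : ∀ {f : E × E → E} {a : E}, DifferentiableAt ℝ f (a, e) →
      fderiv ℝ (fun b => f (a, b)) e = (fderiv ℝ f (a, e)).comp (.inr ℝ E E) := by
    intro f a hf
    have h1 : HasFDerivAt (fun b : E => (a, b)) (.inr ℝ E E) e := hasFDerivAt_prodMk_right a e
    exact (hf.hasFDerivAt.comp e h1).fderiv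
  have fd : ∀ {f : E × E → E}, ContDiffAt ℝ 2 f (e, e) →
      HasFDerivAt (fderiv ℝ f) (fderiv ℝ (fderiv ℝ f) (e, e)) (e, e) := fun hf =>
    ((hf.fderiv_right (m := 1) (by norm_num)).differentiableAt (by simp)).hasFDerivAt
  have hin : HasFDerivAt (fun a : E => (a, e)) (.inl ℝ E E) e := hasFDerivAt_prodMk_left e e
  have hinr : HasFDerivAt (fun a : E => (e, a)) (.inr ℝ E E) e := hasFDerivAt_prodMk_right e e
  have dpart : ∀ {f : E × E → E}, ContDiffAt ℝ 2 f (e, e) →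
      HasFDerivAt (fun a => fderiv ℝ (fun b => f (a, b)) e)
        (((ContinuousLinearMap.compL ℝ E (E × E) E).flip (.inr ℝ E E)).comp
          ((fderiv ℝ (fderiv ℝ f) (e, e)).comp (.inl ℝ E E))) e := by
    intro f hf
    have h1 := HasFDerivAt.comp (f := fun a : E => (a, e)) e (fd hf) hin
    have h2 := (((ContinuousLinearMap.compL ℝ E (E × E) E).flip
      (.inr ℝ E E)).hasFDerivAt (x := fderiv ℝ f (e,e))).comp e h1
    refine h2.congr_of_eventuallyEq ?_
    filter_upwards [hl.eventually (evd hf)] with a ha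
    simp [part ha]
  set D2 := fderiv ℝ (fderiv ℝ m) (e, e) with hD2
  have hxi : ∀ y z : E, fderiv ℝ (fun a => fderiv ℝ (fun b => m (a, b)) e y) e z
      = D2 (z, 0) (0, y) := by
    intro y z
    rw [((dpart hm).clm_apply (hasFDerivAt_const y e)).fderiv]
    simp [hD2]
  refine ⟨_, dpart hc, fun y z => ?_⟩
  set D := (((ContinuousLinearMap.compL ℝ E (E × E) E).flip (.inr ℝ E E)).comp
          ((fderiv ℝ (fderiv ℝ c) (e, e)).comp (.inl ℝ E E))) with hD
  rw [hxi, hxi]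
  -- first order identity
  have key : ∀ᶠ a in 𝓝 e, fderiv ℝ m (e, a) (fderiv ℝ (fun b => c (a, b)) e y, 0)
      = fderiv ℝ (fun b => m (a, b)) e y := by
    filter_upwards [hl.eventually (evd hm), hr.eventually (evd hm), hl.eventually (evd hc),
      hl.eventually hmc.eventually_nhds, hce] with a h1 h2 h3 h4 h5
    have h6 : (fun b => m (c (a, b), a)) =ᶠ[𝓝 e] fun b => m (a, b) := by
      have : Tendsto (fun b : E => (a, b)) (𝓝 e) (𝓝 (a, e)) := by
        have : Continuous (fun b : E => (a, b)) := by fun_prop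
        exact this.tendsto e
      exact this.eventually h4
    rw [← h6.fderiv_eq]
    have h7 : HasFDerivAt (fun b => c (a, b)) (fderiv ℝ (fun b => c (a, b)) e) e := by
      rw [part h3]
      exact h3.hasFDerivAt.comp e (hasFDerivAt_prodMk_right a e)
    have h8 := h7.prodMk (hasFDerivAt_const a e)
    have h9 : HasFDerivAt m (fderiv ℝ m (e, a)) (c (a, e), a) := by
      rw [h5]; exact h2.hasFDerivAt
    have h10 := HasFDerivAt.comp (f := fun b => (c (a, b), a)) e h9 h8
    rw [Function.comp_def] at h10
    simp [h10.fderiv]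
  have hA := (dpart hc).clm_apply (hasFDerivAt_const y e)
  have hA2 := hA.prodMk (hasFDerivAt_const (0 : E) e)
  have hL := (HasFDerivAt.comp (f := fun a : E => (e, a)) e (fd hm) hinr).clm_apply hA2
  have hR := (dpart hm).clm_apply (hasFDerivAt_const y e)
  have heq := (hL.congr_of_eventuallyEq (key.mono fun _ h => h.symm)).unique hR
  have heq2 := congrArg (fun T => T z) heq
  have hfst : ∀ w, fderiv ℝ m (e, e) (w, 0) = w := by
    intro w
    have h1 := HasFDerivAt.comp (f := fun a : E => (a, e)) e (evd hm).self_of_nhds.hasFDerivAt hin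
    have h2 := (h1.congr_of_eventuallyEq (h_one.mono fun _ h => h.symm)).unique (hasFDerivAt_id e)
    simpa using congrArg (fun T => T w) h2
  have hsymm : D2 (y, 0) (0, z) = D2 (0, z) (y, 0) :=
    hm.isSymmSndFDerivAt (by simp) _ _
  have hinv : fderiv ℝ (fun b => c (e, b)) e y = y := by
    have h1 := key.self_of_nhds
    have h2 : (fun b => m (e, b)) =ᶠ[𝓝 e] id := one_h
    rwa [hfst, h2.fderiv_eq, fderiv_id] at h1
  simp [hinv, hfst, ← hD2] at heq2
  rw [hsymm, ← heq2]
  simp [hD]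

noncomputable section
namespace LieTracking

variable {E : Type*} [NormedAddCommGroup E] [NormedSpace ℝ E] {H : Type*} [TopologicalSpace H]
  (I : ModelWithCorners ℝ E H)
  {G : Type*} [TopologicalSpace G] [ChartedSpace H G] [Group G]

/-- The adjoint representation read in the preferred chart at the identity, as a continuous
linear endomorphism of the model space. -/
def chartAd (x : G) : E →L[ℝ] E :=
  fderiv ℝ (fun b => extChartAt I (1 : G) (x * (extChartAt I (1 : G)).symm b * x⁻¹))
    (extChartAt I (1 : G) 1)

theorem eventually_extChartAt_symm_right_inv [I.Boundaryless] :
    ∀ᶠ a in 𝓝 (extChartAt I (1 : G) 1),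
      extChartAt I (1 : G) ((extChartAt I (1 : G)).symm a) = a := by
  filter_upwards [extChartAt_target_mem_nhds (I := I) (1 : G)] with a ha
  exact (extChartAt I (1 : G)).right_inv ha

theorem eventually_extChartAt_left_inv :
    ∀ᶠ g in 𝓝 (1 : G), (extChartAt I (1 : G)).symm (extChartAt I (1 : G) g) = g := by
  filter_upwards [extChartAt_source_mem_nhds (I := I) (1 : G)] with a ha
  exact (extChartAt I (1 : G)).left_inv ha

theorem contMDiffAt_extChartAt_one [IsManifold I ∞ G] {g : G} (hg : g = 1) :
    ContMDiffAt I 𝓘(ℝ, E) ∞ (extChartAt I (1 : G)) g := by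
  subst hg
  exact contMDiffAt_extChartAt

variable [I.Boundaryless] [LieGroup I ∞ G]

theorem contMDiffAt_extChartAt_symm_one :
    ContMDiffAt 𝓘(ℝ, E) I ∞ (extChartAt I (1 : G)).symm (extChartAt I (1 : G) 1) :=
  (contMDiffOn_extChartAt_symm (1 : G)).contMDiffAt (extChartAt_target_mem_nhds (1 : G))

theorem contDiffAt_conj_chart (x : G) :
    ContDiffAt ℝ ∞ (fun b => extChartAt I (1 : G) (x * (extChartAt I (1 : G)).symm b * x⁻¹))
    (extChartAt I (1 : G) 1) := by
  rw [← contMDiffAt_iff_contDiffAt]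
  have h1 := contMDiffAt_extChartAt_symm_one I (G := G)
  have h2 := ((contMDiffAt_const (c := x)).mul h1).mul (contMDiffAt_const (c := x⁻¹))
  refine ContMDiffAt.comp (I' := I) (extChartAt I (1 : G) 1) (contMDiffAt_extChartAt_one I ?_) h2
  simp

theorem contDiffAt_conj_chart_prod :
    ContDiffAt ℝ ∞ (fun p : E × E => extChartAt I (1 : G) ((extChartAt I (1 : G)).symm p.1 *
      (extChartAt I (1 : G)).symm p.2 * ((extChartAt I (1 : G)).symm p.1)⁻¹))
      (extChartAt I (1 : G) 1, extChartAt I (1 : G) 1) := by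
  rw [← contMDiffAt_iff_contDiffAt]
  have h1 := ContMDiffAt.comp (f := Prod.fst)
    (extChartAt I (1 : G) 1, extChartAt I (1 : G) 1)
    (contMDiffAt_extChartAt_symm_one I (G := G)) (contDiff_fst (E := E) (F := E)).contMDiff.contMDiffAt
  have h2 := ContMDiffAt.comp (f := Prod.snd)
    (extChartAt I (1 : G) 1, extChartAt I (1 : G) 1)
    (contMDiffAt_extChartAt_symm_one I (G := G)) (contDiff_snd (E := E) (F := E)).contMDiff.contMDiffAt
  refine ContMDiffAt.comp (I' := I) _ (contMDiffAt_extChartAt_one I ?_) ((h1.mul h2).mul h1.inv)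
  simp

theorem contDiffAt_mul_chart_prod :
    ContDiffAt ℝ ∞ (fun p : E × E => extChartAt I (1 : G) ((extChartAt I (1 : G)).symm p.1 *
      (extChartAt I (1 : G)).symm p.2))
      (extChartAt I (1 : G) 1, extChartAt I (1 : G) 1) := by
  rw [← contMDiffAt_iff_contDiffAt]
  have h1 := ContMDiffAt.comp (f := Prod.fst)
    (extChartAt I (1 : G) 1, extChartAt I (1 : G) 1)
    (contMDiffAt_extChartAt_symm_one I (G := G)) (contDiff_fst (E := E) (F := E)).contMDiff.contMDiffAt
  have h2 := ContMDiffAt.comp (f := Prod.snd)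
    (extChartAt I (1 : G) 1, extChartAt I (1 : G) 1)
    (contMDiffAt_extChartAt_symm_one I (G := G)) (contDiff_snd (E := E) (F := E)).contMDiff.contMDiffAt
  refine ContMDiffAt.comp (I' := I) _ (contMDiffAt_extChartAt_one I ?_) (h1.mul h2)
  simp

theorem hasFDerivAt_conj_chart (x : G) :
    HasFDerivAt (fun b => extChartAt I (1 : G) (x * (extChartAt I (1 : G)).symm b * x⁻¹))
      (chartAd I x) (extChartAt I (1 : G) 1) :=
  ((contDiffAt_conj_chart I x).differentiableAt (by simp)).hasFDerivAt

theorem tendsto_conj_chart (x : G) :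
    Tendsto (fun b => x * (extChartAt I (1 : G)).symm b * x⁻¹) (𝓝 (extChartAt I (1 : G) 1))
      (𝓝 1) := by
  have h1 := contMDiffAt_extChartAt_symm_one I (G := G)
  have h2 := (((contMDiffAt_const (c := x)).mul h1).mul (contMDiffAt_const (c := x⁻¹))).continuousAt
  have h3 : x * (extChartAt I (1 : G)).symm (extChartAt I (1 : G) 1) * x⁻¹ = 1 := by simp
  have h4 : Tendsto (fun b => x * (extChartAt I (1 : G)).symm b * x⁻¹)
    (𝓝 (extChartAt I (1 : G) 1)) (𝓝 (x * (extChartAt I (1 : G)).symm (extChartAt I (1 : G) 1) * x⁻¹)) := h2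
  rwa [h3] at h4

theorem chartAd_mul (x y : G) : chartAd I (x * y) = (chartAd I x).comp (chartAd I y) := by
  have h1 : HasFDerivAt (fun b => extChartAt I (1 : G) (x * (extChartAt I (1 : G)).symm b * x⁻¹))
      (chartAd I x)
      (extChartAt I (1 : G) (y * (extChartAt I (1 : G)).symm (extChartAt I (1 : G) 1) * y⁻¹)) := by
    simpa using hasFDerivAt_conj_chart I x
  have h2 := HasFDerivAt.comp (f := fun b => extChartAt I (1 : G) (y * (extChartAt I (1 : G)).symm b * y⁻¹)) _ h1 (hasFDerivAt_conj_chart I y)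
  refine ((hasFDerivAt_conj_chart I (x * y)).congr_of_eventuallyEq ?_).unique h2
  filter_upwards [(tendsto_conj_chart I y).eventually (eventually_extChartAt_left_inv I)] with b hb
  simp only [Function.comp_apply, hb]
  simp [mul_assoc]

theorem chartAd_one : chartAd I (1 : G) = .id ℝ E := by
  have h := hasFDerivAt_conj_chart I (1 : G)
  refine h.unique ((hasFDerivAt_id _).congr_of_eventuallyEq ?_)
  filter_upwards [eventually_extChartAt_symm_right_inv I (G := G)] with b hb
  simpa using hb

theorem Ad_apply (x : G) (v : GroupLieAlgebra I G) : Ad I x v = chartAd I x v := by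
  have h : MDifferentiableAt I I (fun y : G => x * y * x⁻¹) 1 :=
    (((contMDiff_const (c := x)).mul contMDiff_id).mul (contMDiff_const (c := x⁻¹))
      : ContMDiff I I ∞ _).mdifferentiable (by simp) 1
  have h1 : x * 1 * x⁻¹ = 1 := by simp
  have h2 : (mfderiv I I (fun y : G => x * y * x⁻¹) (1 : G) : E →L[ℝ] E) = chartAd I x := by
    refine h.mfderiv.trans ?_
    simp only [writtenInExtChartAt, chartAd, I.range_eq_univ, fderivWithin_univ,
      Function.comp_def, h1]
    rfl
  exact DFunLike.congr_fun h2 v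

end LieTracking
end

noncomputable section
namespace LieTracking

variable {E : Type*} [NormedAddCommGroup E] [NormedSpace ℝ E] {H : Type*} [TopologicalSpace H]
  (I : ModelWithCorners ℝ E H)
  {G : Type*} [TopologicalSpace G] [ChartedSpace H G] [Group G]

/-- The left-invariant vector field with value `v` at the identity, read in the preferred chart
at the identity. -/
def chartInvariantField (G : Type*) [TopologicalSpace G] [ChartedSpace H G] [Group G]
    (v a : E) : E :=
  fderiv ℝ (fun b => extChartAt I (1 : G) ((extChartAt I (1 : G)).symm a *
    (extChartAt I (1 : G)).symm b)) (extChartAt I (1 : G) 1) v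

variable [I.Boundaryless] [LieGroup I ∞ G]

theorem mpullbackWithin_mulInvariantVectorField (v : GroupLieAlgebra I G) {a : E}
    (ha : a ∈ (extChartAt I (1 : G)).target) :
    VectorField.mpullbackWithin 𝓘(ℝ, E) I (extChartAt I (1 : G)).symm
      (mulInvariantVectorField v) (Set.range I) a = chartInvariantField I G v a := by
  have hs := (extChartAt I (1 : G)).map_target ha
  set g := (extChartAt I (1 : G)).symm a with hg
  have hinv : (mfderivWithin 𝓘(ℝ, E) I (extChartAt I (1 : G)).symm (Set.range I) a).inverse
      = mfderiv I 𝓘(ℝ, E) (extChartAt I (1 : G)) g := by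
    refine ContinuousLinearMap.inverse_eq ?_ ?_
    · exact mfderivWithin_extChartAt_symm_comp_mfderiv_extChartAt ha
    · exact mfderiv_extChartAt_comp_mfderivWithin_extChartAt_symm ha
  have h0 : MDifferentiableAt I I (fun y : G => g * y) 1 :=
    (contMDiff_mul_left (I := I) (n := ∞) (a := g)).mdifferentiable (by simp) 1
  have h1 : HasMFDerivAt I 𝓘(ℝ, E) (extChartAt I (1 : G)) (g * 1)
      (mfderiv I 𝓘(ℝ, E) (extChartAt I (1 : G)) (g * 1)) := by
    refine (mdifferentiableAt_extChartAt ?_).hasMFDerivAt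
    simpa [extChartAt_source] using hs
  have h2 := HasMFDerivAt.comp (1 : G) h1 h0.hasMFDerivAt
  rw [VectorField.mpullbackWithin_apply, hinv]
  have h3 : HasFDerivAt (fun b => extChartAt I (1 : G) (g * (extChartAt I (1 : G)).symm b))
      (show E →L[ℝ] E from (mfderiv I 𝓘(ℝ, E) (extChartAt I (1 : G)) (g * 1)).comp
        (mfderiv I I (fun y : G => g * y) 1)) (extChartAt I (1 : G) 1) := by
    have := h2.2
    rw [I.range_eq_univ] at this
    exact hasFDerivWithinAt_univ.1 this
  unfold chartInvariantField
  rw [← hg, h3.fderiv]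
  change _ = mfderiv I 𝓘(ℝ, E) (extChartAt I (1 : G)) (g * 1)
    (mfderiv I I (fun y : G => g * y) 1 v)
  rw [mul_one]
  rfl

theorem mlieBracket_eq_lieBracket_chartInvariantField (v w : GroupLieAlgebra I G) :
    VectorField.mlieBracket I (mulInvariantVectorField v) (mulInvariantVectorField w) (1 : G) =
      VectorField.lieBracket ℝ (chartInvariantField I G v) (chartInvariantField I G w)
        (extChartAt I (1 : G) 1) := by
  have key : ∀ u : GroupLieAlgebra I G, VectorField.mpullbackWithin 𝓘(ℝ, E) I
      (extChartAt I (1 : G)).symm (mulInvariantVectorField u) (Set.range I)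
      =ᶠ[𝓝 (extChartAt I (1 : G) 1)] chartInvariantField I G u := fun u => by
    filter_upwards [extChartAt_target_mem_nhds (I := I) (1 : G)] with a ha
    exact mpullbackWithin_mulInvariantVectorField I u ha
  rw [← VectorField.mlieBracketWithin_univ, VectorField.mlieBracketWithin_apply,
    mfderiv_extChartAt_self]
  refine (DFunLike.congr_fun (F := E →L[ℝ] E)
    (ContinuousLinearMap.inverse_id (R := ℝ) (M := E)) _).trans ?_
  change VectorField.lieBracketWithin ℝ _ _ _ _ = _
  rw [Set.preimage_univ, Set.univ_inter, I.range_eq_univ]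
  rw [I.range_eq_univ] at key
  exact (congrFun VectorField.lieBracketWithin_univ _).trans
    (Filter.EventuallyEq.lieBracket_vectorField_eq (key v) (key w))

theorem exists_hasFDerivAt_chartAd :
    ∃ D : E →L[ℝ] E →L[ℝ] E,
      HasFDerivAt (fun a => chartAd I ((extChartAt I (1 : G)).symm a)) D (extChartAt I (1 : G) 1) ∧
      ∀ v w : E, D v w = @Bracket.bracket (GroupLieAlgebra I G) (GroupLieAlgebra I G) _ v w := by
  have hm : ContDiffAt ℝ 2 _ _ := (contDiffAt_mul_chart_prod I (G := G)).of_le (by exact_mod_cast ENat.LEInfty.out)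
  have hc : ContDiffAt ℝ 2 _ _ := (contDiffAt_conj_chart_prod I (G := G)).of_le (by exact_mod_cast ENat.LEInfty.out)
  have hone : ∀ᶠ a in 𝓝 (extChartAt I (1 : G) 1), extChartAt I (1 : G)
      ((extChartAt I (1 : G)).symm a * (extChartAt I (1 : G)).symm (extChartAt I (1 : G) 1)) = a := by
    filter_upwards [eventually_extChartAt_symm_right_inv I (G := G)] with b hb
    simpa using hb
  have hone' : ∀ᶠ a in 𝓝 (extChartAt I (1 : G) 1), extChartAt I (1 : G)
      ((extChartAt I (1 : G)).symm (extChartAt I (1 : G) 1) * (extChartAt I (1 : G)).symm a) = a := by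
    filter_upwards [eventually_extChartAt_symm_right_inv I (G := G)] with b hb
    simpa using hb
  have hmc : ∀ᶠ p : E × E in 𝓝 (extChartAt I (1 : G) 1, extChartAt I (1 : G) 1),
      extChartAt I (1 : G) ((extChartAt I (1 : G)).symm (extChartAt I (1 : G)
        ((extChartAt I (1 : G)).symm p.1 * (extChartAt I (1 : G)).symm p.2 *
          ((extChartAt I (1 : G)).symm p.1)⁻¹)) * (extChartAt I (1 : G)).symm p.1) =
      extChartAt I (1 : G) ((extChartAt I (1 : G)).symm p.1 * (extChartAt I (1 : G)).symm p.2) := by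
    have h1 := (contMDiffAt_extChartAt_symm_one I (G := G)).continuousAt
    have h2 : ContinuousAt (fun p : E × E => (extChartAt I (1 : G)).symm p.1)
        (extChartAt I (1 : G) 1, extChartAt I (1 : G) 1) := by
      exact ContinuousAt.comp (f := Prod.fst) h1 continuousAt_fst
    have h3 : ContinuousAt (fun p : E × E => (extChartAt I (1 : G)).symm p.2)
        (extChartAt I (1 : G) 1, extChartAt I (1 : G) 1) := by
      exact ContinuousAt.comp (f := Prod.snd) h1 continuousAt_snd
    have := topologicalGroup_of_lieGroup I ∞ (G := G)
    have h4 := (h2.mul h3).mul h2.inv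
    have h5 : Tendsto (fun p : E × E => (extChartAt I (1 : G)).symm p.1 *
      (extChartAt I (1 : G)).symm p.2 * ((extChartAt I (1 : G)).symm p.1)⁻¹)
      (𝓝 (extChartAt I (1 : G) 1, extChartAt I (1 : G) 1)) (𝓝 1) := by
      simp only [ContinuousAt, Pi.mul_apply, Pi.inv_apply, extChartAt_to_inv, mul_one,
        inv_one] at h4
      exact h4
    filter_upwards [h5.eventually (eventually_extChartAt_left_inv I)] with p hp
    simp only [hp]
    simp
  obtain ⟨D, hD, hD'⟩ :=
    hasFDerivAt_adjoint_of_local_mul hm hc hone hone' hmc (by simp)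
  refine ⟨D, hD, fun v w => ?_⟩
  refine Eq.trans ?_ (mlieBracket_eq_lieBracket_chartInvariantField I v w).symm
  have h1 : ∀ u : E, chartInvariantField I G u (extChartAt I (1 : G) 1) = u := fun u => by
    have : (fun b => extChartAt I (1 : G) ((extChartAt I (1 : G)).symm (extChartAt I (1 : G) 1) *
        (extChartAt I (1 : G)).symm b)) =ᶠ[𝓝 (extChartAt I (1 : G) 1)] id := by
      filter_upwards [eventually_extChartAt_symm_right_inv I (G := G)] with b hb
      simpa using hb
    rw [chartInvariantField, this.fderiv_eq, fderiv_id]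
    rfl
  refine (hD' w v).trans ?_
  simp only [VectorField.lieBracket_eq, h1]
  rfl

end LieTracking
end

theorem exists_basis_forall_eq_sum_of_posDef {V : Type*} [AddCommGroup V] [Module ℝ V]
    [FiniteDimensional ℝ V] (B : V → V → ℝ) (symm : ∀ u v, B u v = B v u)
    (add_left : ∀ u v w, B (u + v) w = B u w + B v w)
    (smul_left : ∀ (r : ℝ) u v, B (r • u) v = r * B u v) (pos : ∀ u, u ≠ 0 → 0 < B u u) :
    ∃ b : Module.Basis (Fin (Module.finrank ℝ V)) ℝ V,
      ∀ u v, B u v = ∑ i, b.repr u i * b.repr v i := by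
  let core : InnerProductSpace.Core ℝ V :=
    { inner := B
      conj_inner_symm := fun u v => symm v u
      re_inner_nonneg := fun u => by
        by_cases hu : u = 0
        · subst hu
          have := smul_left 0 0 0
          simp only [zero_smul, zero_mul] at this
          simp [this]
        · exact (pos u hu).le
      add_left := add_left
      smul_left := fun u v r => smul_left r u v
      definite := fun u hu => by
        by_contra h
        exact (pos u h).ne' hu }
  let : NormedAddCommGroup V := core.toNormedAddCommGroup
  let : InnerProductSpace ℝ V := InnerProductSpace.ofCore core.toCore
  let b := stdOrthonormalBasis ℝ V
  refine ⟨b.toBasis, fun u v => ?_⟩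
  have h := b.sum_inner_mul_inner u v
  change B u v = _
  have h2 : inner ℝ u v = B u v := rfl
  rw [← h2, ← h]
  refine Finset.sum_congr rfl fun i _ => ?_
  rw [b.coe_toBasis_repr_apply, b.coe_toBasis_repr_apply, b.repr_apply_apply,
    b.repr_apply_apply, real_inner_comm]

theorem exists_basis_orthogonal_of_compact_group {G : Type*} [Group G] [TopologicalSpace G]
    [IsTopologicalGroup G] [CompactSpace G] {E : Type*} [NormedAddCommGroup E] [NormedSpace ℝ E]
    [FiniteDimensional ℝ E] (ρ : G → E →L[ℝ] E) (ρ_one : ρ 1 = .id ℝ E)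
    (ρ_mul : ∀ x y, ρ (x * y) = (ρ x).comp (ρ y)) (ρ_cont : Continuous ρ) :
    ∃ b : Module.Basis (Fin (Module.finrank ℝ E)) ℝ E, ∀ g u v,
      ∑ i, b.repr (ρ g u) i * b.repr (ρ g v) i = ∑ i, b.repr u i * b.repr v i := by
  borelize G
  let μ : Measure G := Measure.haar
  let c := Module.finBasis ℝ E
  let β : E → E → ℝ := fun u v => ∑ i, c.repr u i * c.repr v i
  have cc : ∀ i, Continuous fun u => c.repr u i := fun i =>
    LinearMap.continuous_of_finiteDimensional (c.coord i)
  have hf : ∀ u v, Continuous fun g => β (ρ g⁻¹ u) (ρ g⁻¹ v) := fun u v => by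
    refine continuous_finsetSum _ fun i _ => ?_
    have h1 : ∀ w, Continuous fun g : G => ρ g⁻¹ w := fun w => by fun_prop
    exact ((cc i).comp (h1 u)).mul ((cc i).comp (h1 v))
  have hint : ∀ u v, Integrable (fun g => β (ρ g⁻¹ u) (ρ g⁻¹ v)) μ := fun u v =>
    (hf u v).integrable_of_hasCompactSupport (HasCompactSupport.of_compactSpace _)
  let B : E → E → ℝ := fun u v => ∫ g, β (ρ g⁻¹ u) (ρ g⁻¹ v) ∂μ
  obtain ⟨b, hb⟩ := exists_basis_forall_eq_sum_of_posDef B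
    (fun u v => by simp only [B, β, mul_comm])
    (fun u v w => by
      simp only [B]
      rw [← integral_add (hint u w) (hint v w)]
      simp only [β, map_add, Finsupp.add_apply, add_mul, Finset.sum_add_distrib])
    (fun r u v => by
      simp only [B]
      rw [← integral_const_mul]
      simp only [β, map_smul, Finsupp.smul_apply, smul_eq_mul, Finset.mul_sum, mul_assoc])
    (fun u hu => by
      refine (hf u u).integral_pos_of_hasCompactSupport_nonneg_nonzero (x := 1)
        (HasCompactSupport.of_compactSpace _) (fun g => ?_) ?_
      · exact Finset.sum_nonneg fun i _ => mul_self_nonneg _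
      · simp only [inv_one, ρ_one, ContinuousLinearMap.id_apply, β]
        intro h
        rw [Finset.sum_eq_zero_iff_of_nonneg fun i _ => mul_self_nonneg _] at h
        refine hu (c.repr.injective (Finsupp.ext fun i => ?_))
        simpa using h i (Finset.mem_univ i))
  refine ⟨b, fun g u v => ?_⟩
  rw [← hb, ← hb]
  have h := integral_mul_left_eq_self (μ := μ) (fun h => β (ρ h⁻¹ u) (ρ h⁻¹ v)) g⁻¹
  simpa [ρ_mul, B] using h

noncomputable section

/-- The trace of continuous linear endomorphisms of a finite-dimensional space, as a continuous
linear form. -/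
def ContinuousLinearMap.traceCLM (E : Type*) [NormedAddCommGroup E] [NormedSpace ℝ E]
    [FiniteDimensional ℝ E] : (E →L[ℝ] E) →L[ℝ] ℝ :=
  LinearMap.toContinuousLinearMap ((LinearMap.trace ℝ E).comp (ContinuousLinearMap.coeLM ℝ))

@[simp]
theorem ContinuousLinearMap.traceCLM_apply {E : Type*} [NormedAddCommGroup E] [NormedSpace ℝ E]
    [FiniteDimensional ℝ E] (A : E →L[ℝ] E) :
    ContinuousLinearMap.traceCLM E A = LinearMap.trace ℝ E A := rfl

namespace LieTracking

/-- The linear form `Z ↦ tr (A ∘ D Z)`, as a continuous linear function of `A`. -/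
def traceForm {E : Type*} [NormedAddCommGroup E] [NormedSpace ℝ E] [FiniteDimensional ℝ E]
    (D : E →L[ℝ] E →L[ℝ] E) : (E →L[ℝ] E) →L[ℝ] (E →L[ℝ] ℝ) :=
  (ContinuousLinearMap.compL ℝ E (E →L[ℝ] E) ℝ (ContinuousLinearMap.traceCLM E)).comp
    (((ContinuousLinearMap.compL ℝ E (E →L[ℝ] E) (E →L[ℝ] E)).flip D).comp
      (ContinuousLinearMap.compL ℝ E E E))

@[simp]
theorem traceForm_apply {E : Type*} [NormedAddCommGroup E] [NormedSpace ℝ E]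
    [FiniteDimensional ℝ E] (D : E →L[ℝ] E →L[ℝ] E) (A : E →L[ℝ] E) (z : E) :
    traceForm D A z = LinearMap.trace ℝ E (A.comp (D z) : E →L[ℝ] E) := rfl

variable {E : Type*} [NormedAddCommGroup E] [NormedSpace ℝ E] {H : Type*} [TopologicalSpace H]
  (I : ModelWithCorners ℝ E H)
  {G : Type*} [TopologicalSpace G] [ChartedSpace H G] [Group G]

theorem continuousAt_one_of_continuousAt_chart {F : Type*} [TopologicalSpace F] {f : G → F}
    (hf : ContinuousAt (fun a => f ((extChartAt I (1 : G)).symm a)) (extChartAt I (1 : G) 1)) :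
    ContinuousAt f 1 := by
  have h := ContinuousAt.comp (f := extChartAt I (1 : G)) hf (continuousAt_extChartAt (1 : G))
  refine h.congr ?_
  filter_upwards [eventually_extChartAt_left_inv I (G := G)] with g hg
  simp only [Function.comp_apply, hg]

variable [I.Boundaryless]

theorem hasMFDerivAt_one_of_hasFDerivAt_chart {F : Type*} [NormedAddCommGroup F] [NormedSpace ℝ F]
    {f : G → F} {f' : E →L[ℝ] F}
    (hf : HasFDerivAt (fun a => f ((extChartAt I (1 : G)).symm a)) f' (extChartAt I (1 : G) 1)) :
    HasMFDerivAt I 𝓘(ℝ, F) f 1 f' := by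
  refine ⟨continuousAt_one_of_continuousAt_chart I hf.continuousAt, ?_⟩
  rw [I.range_eq_univ]
  exact hasFDerivWithinAt_univ.2 hf

variable [LieGroup I ∞ G]

theorem continuous_chartAd : Continuous (chartAd I : G → E →L[ℝ] E) := by
  have := topologicalGroup_of_lieGroup I ∞ (G := G)
  obtain ⟨D, hD, -⟩ := exists_hasFDerivAt_chartAd I (G := G)
  have h1 := continuousAt_one_of_continuousAt_chart I hD.continuousAt
  refine continuous_iff_continuousAt.2 fun w => ?_
  have h2 : ContinuousAt (fun g => w⁻¹ * g) w := by fun_prop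
  have h3 : ContinuousAt (fun g => chartAd I (w⁻¹ * g)) w :=
    ContinuousAt.comp (f := fun g => w⁻¹ * g) (g := chartAd I) (by simpa using h1) h2
  have h4 : (chartAd I : G → E →L[ℝ] E) = fun g => (chartAd I w).comp (chartAd I (w⁻¹ * g)) := by
    funext g
    rw [← chartAd_mul, mul_inv_cancel_left]
  rw [h4]
  exact continuousAt_const.clm_comp h3

theorem V_eq_trace_chartAd (w : G) : V I w = LinearMap.trace ℝ E (chartAd I w) := by
  have : Ad I w = (chartAd I w : E →ₗ[ℝ] E) := LinearMap.ext fun v => Ad_apply I w v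
  rw [V, this]
  rfl

variable [FiniteDimensional ℝ E]

theorem hasFDerivAt_V_mul_chart {D : E →L[ℝ] E →L[ℝ] E}
    (hD : HasFDerivAt (fun a => chartAd I ((extChartAt I (1 : G)).symm a)) D
      (extChartAt I (1 : G) 1)) (w : G) :
    HasFDerivAt (fun a => V I (w * (extChartAt I (1 : G)).symm a))
      (traceForm D (chartAd I w)) (extChartAt I (1 : G) 1) := by
  have h := (((ContinuousLinearMap.traceCLM E).comp
    (ContinuousLinearMap.compL ℝ E E E (chartAd I w))).hasFDerivAt).comp
      (extChartAt I (1 : G) 1) hD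
  refine h.congr_of_eventuallyEq (Eventually.of_forall fun a => ?_)
  simp [V_eq_trace_chartAd, chartAd_mul]

theorem mfderiv_V_mulInvariantVectorField {D : E →L[ℝ] E →L[ℝ] E}
    (hD : HasFDerivAt (fun a => chartAd I ((extChartAt I (1 : G)).symm a)) D
      (extChartAt I (1 : G) 1)) (w : G) (v : GroupLieAlgebra I G) :
    mfderiv I 𝓘(ℝ, ℝ) (V I : G → ℝ) w (mulInvariantVectorField v w) =
      traceForm D (chartAd I w) v := by
  have h1 : HasMFDerivAt I 𝓘(ℝ, ℝ) (fun g => V I (w * g)) (1 : G) (traceForm D (chartAd I w)) :=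
    hasMFDerivAt_one_of_hasFDerivAt_chart I (hasFDerivAt_V_mul_chart I hD w)
  have hl : ∀ x : G, MDifferentiable I I (fun g : G => x * g) := fun x =>
    (contMDiff_mul_left (I := I) (n := ∞) (a := x)).mdifferentiable (by simp)
  have h2 : MDifferentiableAt I 𝓘(ℝ, ℝ) (V I) (w * 1) := by
    have h3 : (V I : G → ℝ) = (fun g => V I (w * g)) ∘ fun g => w⁻¹ * g := by
      funext g
      simp
    rw [h3]
    refine MDifferentiableAt.comp (I' := I) _ ?_ (hl _ _)
    rw [inv_mul_cancel_left]
    exact h1.mdifferentiableAt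
  have h4 := HasMFDerivAt.comp (1 : G) h2.hasMFDerivAt (hl w 1).hasMFDerivAt
  have h5 := hasMFDerivAt_unique h4 h1
  have h6 := congrArg (fun g => (show E →L[ℝ] ℝ from mfderiv I 𝓘(ℝ, ℝ) (V I) g)) (mul_one w)
  have h7 := DFunLike.congr_fun (F := E →L[ℝ] ℝ) h6.symm (mulInvariantVectorField v w)
  refine h7.trans ?_
  exact DFunLike.congr_fun (F := E →L[ℝ] ℝ) h5 v

theorem mem_criticalSet_iff {D : E →L[ℝ] E →L[ℝ] E}
    (hD : HasFDerivAt (fun a => chartAd I ((extChartAt I (1 : G)).symm a)) D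
      (extChartAt I (1 : G) 1)) {m : ℕ} {X : Fin m → GroupLieAlgebra I G} {xr : ℝ → G}
    (hreg : IsRegularTrajectory I X xr) (w : G) :
    w ∈ criticalSet I X xr ↔ traceForm D (chartAd I w) = 0 := by
  constructor
  · intro hw
    have ha : ∀ t k, auxCoeff I X xr k t w = 0 := by
      intro t
      have h1 : mfderiv I 𝓘(ℝ, ℝ) (V I : G → ℝ) w (auxField I X xr t w) = 0 := by
        rw [hw t]
        exact map_zero _
      have h2 : ∑ k, auxCoeff I X xr k t w * auxCoeff I X xr k t w = 0 := by
        refine Eq.trans ?_ h1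
        rw [auxField]
        refine Eq.trans ?_ (map_sum _ _ _).symm
        refine Finset.sum_congr rfl fun k _ => ?_
        exact (map_smul (mfderiv I 𝓘(ℝ, ℝ) (V I : G → ℝ) w) _ _).symm
      rw [Finset.sum_eq_zero_iff_of_nonneg fun k _ => mul_self_nonneg _] at h2
      exact fun k => mul_self_eq_zero.1 (h2 k (Finset.mem_univ k))
    let f : GroupLieAlgebra I G →ₗ[ℝ] ℝ := (traceForm D (chartAd I w)).toLinearMap
    have h3 : (⊤ : Submodule ℝ (GroupLieAlgebra I G)) ≤ LinearMap.ker f := by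
      rw [← show _ = _ from hreg, Submodule.span_le]
      rintro _ ⟨t, k, rfl⟩
      exact (mfderiv_V_mulInvariantVectorField I hD w _).symm.trans (ha t k)
    ext z
    exact h3 (x := z) trivial
  · intro hw t
    rw [auxField]
    refine Finset.sum_eq_zero fun k _ => ?_
    have : auxCoeff I X xr k t w = 0 := by
      rw [auxCoeff, mfderiv_V_mulInvariantVectorField I hD, hw]
      rfl
    rw [this, zero_smul]

theorem traceForm_conj_eq_zero {D : E →L[ℝ] E →L[ℝ] E}
    (hD : HasFDerivAt (fun a => chartAd I ((extChartAt I (1 : G)).symm a)) D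
      (extChartAt I (1 : G) 1)) {x : G} (y : G) (hx : traceForm D (chartAd I x) = 0) :
    traceForm D (chartAd I (y * x * y⁻¹)) = 0 := by
  have h1 := hasFDerivAt_V_mul_chart I hD (y * x * y⁻¹)
  have h2 := hasFDerivAt_V_mul_chart I hD x
  rw [hx] at h2
  have h3 := hasFDerivAt_conj_chart I y⁻¹
  have h4 := HasFDerivAt.comp (f := fun b => extChartAt I (1 : G)
    (y⁻¹ * (extChartAt I (1 : G)).symm b * y⁻¹⁻¹)) (extChartAt I (1 : G) 1)
    (g := fun a => V I (x * (extChartAt I (1 : G)).symm a)) (g' := 0)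
    (by simpa using h2) h3
  rw [ContinuousLinearMap.zero_comp] at h4
  refine h1.unique (h4.congr_of_eventuallyEq ?_)
  filter_upwards [(tendsto_conj_chart I y⁻¹).eventually (eventually_extChartAt_left_inv I)]
    with b hb
  simp only [Function.comp_apply, hb]
  have h5 : ∀ g h : G, V I (g * h) = V I (h * g) := fun g h => by
    rw [V_eq_trace_chartAd, V_eq_trace_chartAd, chartAd_mul, chartAd_mul]
    exact LinearMap.trace_mul_comm ℝ (chartAd I g : E →ₗ[ℝ] E) (chartAd I h)
  rw [inv_inv, mul_assoc, mul_assoc, h5, mul_assoc, mul_assoc]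

end LieTracking
end

noncomputable section
namespace LieTracking

variable {E : Type*} [NormedAddCommGroup E] [NormedSpace ℝ E] [FiniteDimensional ℝ E]
  {H : Type*} [TopologicalSpace H]
  (I : ModelWithCorners ℝ E H)
  {G : Type*} [TopologicalSpace G] [ChartedSpace H G] [Group G]
  [I.Boundaryless] [LieGroup I ∞ G]

theorem exists_basis_transpose_chartAd [CompactSpace G] {D : E →L[ℝ] E →L[ℝ] E}
    (hD : HasFDerivAt (fun a => chartAd I ((extChartAt I (1 : G)).symm a)) D
      (extChartAt I (1 : G) 1)) :
    ∃ b : Module.Basis (Fin (Module.finrank ℝ E)) ℝ E,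
      (∀ g : G, LinearMap.toMatrix b b (chartAd I g⁻¹ : E →L[ℝ] E) =
        (LinearMap.toMatrix b b (chartAd I g : E →L[ℝ] E)).transpose) ∧
      ∀ z : E, (LinearMap.toMatrix b b (D z : E →L[ℝ] E)).transpose =
        - LinearMap.toMatrix b b (D z : E →L[ℝ] E) := by
  have := topologicalGroup_of_lieGroup I ∞ (G := G)
  obtain ⟨b, hb⟩ := exists_basis_orthogonal_of_compact_group (chartAd I : G → E →L[ℝ] E)
    (chartAd_one I) (chartAd_mul I) (continuous_chartAd I)
  refine ⟨b, fun g => ?_, fun z => ?_⟩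
  · have h1 : (LinearMap.toMatrix b b (chartAd I g : E →L[ℝ] E)).transpose *
        LinearMap.toMatrix b b (chartAd I g : E →L[ℝ] E) = 1 := by
      ext j k
      rw [Matrix.mul_apply]
      simp only [Matrix.transpose_apply, LinearMap.toMatrix_apply]
      refine (hb g (b j) (b k)).trans ?_
      simp [Finsupp.single_apply, Matrix.one_apply]
    have h2 : LinearMap.toMatrix b b (chartAd I g : E →L[ℝ] E) *
        LinearMap.toMatrix b b (chartAd I g⁻¹ : E →L[ℝ] E) = 1 := by
      rw [← LinearMap.toMatrix_comp, ← ContinuousLinearMap.toLinearMap_comp, ← chartAd_mul,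
        mul_inv_cancel, chartAd_one]
      exact LinearMap.toMatrix_id b
    exact (left_inv_eq_right_inv h1 h2).symm
  · have hc : ∀ i u, HasFDerivAt (fun a => b.repr (chartAd I ((extChartAt I (1 : G)).symm a) u) i)
        ((LinearMap.toContinuousLinearMap (b.coord i)).comp (D.flip u))
          (extChartAt I (1 : G) 1) := fun i u => by
      have h1 := hD.clm_apply (hasFDerivAt_const u (extChartAt I (1 : G) 1))
      have h2 := (LinearMap.toContinuousLinearMap (b.coord i)).hasFDerivAt.comp
        (extChartAt I (1 : G) 1) h1
      refine h2.congr_fderiv ?_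
      ext v
      simp
    have skew : ∀ u v, ∑ i, (b.repr u i * b.repr (D z v) i + b.repr v i * b.repr (D z u) i) = 0 := by
      intro u v
      have h1 := HasFDerivAt.fun_sum (u := Finset.univ) fun i _ => (hc i u).mul (hc i v)
      have h2 := (h1.congr_of_eventuallyEq (f₁ := fun _ => ∑ i, b.repr u i * b.repr v i)
        (Eventually.of_forall fun a => (hb _ u v).symm)).unique
        (hasFDerivAt_const _ _)
      have h3 := DFunLike.congr_fun h2 z
      simpa [chartAd_one] using h3
    ext j k
    have h := skew (b j) (b k)
    simp [Finset.sum_add_distrib, Finsupp.single_apply] at h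
    simp only [Matrix.transpose_apply, Matrix.neg_apply, LinearMap.toMatrix_apply]
    exact eq_neg_of_add_eq_zero_right h

theorem traceForm_inv_eq_zero [CompactSpace G] {D : E →L[ℝ] E →L[ℝ] E}
    (hD : HasFDerivAt (fun a => chartAd I ((extChartAt I (1 : G)).symm a)) D
      (extChartAt I (1 : G) 1)) {x : G} (hx : traceForm D (chartAd I x) = 0) :
    traceForm D (chartAd I x⁻¹) = 0 := by
  obtain ⟨b, hb, hb'⟩ := exists_basis_transpose_chartAd I hD
  ext z
  have h := DFunLike.congr_fun hx z
  simp only [traceForm_apply, ContinuousLinearMap.toLinearMap_comp,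
    LinearMap.trace_eq_matrix_trace ℝ b, LinearMap.toMatrix_comp b b b,
    zero_apply] at h ⊢
  rw [hb, ← neg_neg (LinearMap.toMatrix b b (D z : E →L[ℝ] E)), ← hb', mul_neg, Matrix.trace_neg,
    ← Matrix.transpose_mul, Matrix.trace_transpose, Matrix.trace_mul_comm, h, neg_zero]

theorem eq_zero_of_trace_comp_self_eq_zero [CompactSpace G] {D : E →L[ℝ] E →L[ℝ] E}
    (hD : HasFDerivAt (fun a => chartAd I ((extChartAt I (1 : G)).symm a)) D
      (extChartAt I (1 : G) 1)) {z : E}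
    (hz : LinearMap.trace ℝ E ((D z).comp (D z) : E →L[ℝ] E) = 0) : D z = 0 := by
  obtain ⟨b, -, hb'⟩ := exists_basis_transpose_chartAd I hD
  rw [ContinuousLinearMap.toLinearMap_comp, LinearMap.trace_eq_matrix_trace ℝ b,
    LinearMap.toMatrix_comp b b b] at hz
  have h : ((LinearMap.toMatrix b b (D z : E →L[ℝ] E)).conjTranspose *
      LinearMap.toMatrix b b (D z : E →L[ℝ] E)).trace = 0 := by
    rw [Matrix.conjTranspose_eq_transpose_of_trivial, hb', neg_mul, Matrix.trace_neg, hz, neg_zero]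
  rw [Matrix.trace_conjTranspose_mul_self_eq_zero_iff] at h
  have h2 := (LinearMap.toMatrix b b).injective (h.trans (map_zero _).symm)
  ext v
  exact DFunLike.congr_fun h2 v

theorem eventually_traceForm_chartAd_ne_zero [CompactSpace G]
    [LieAlgebra.HasTrivialRadical ℝ (GroupLieAlgebra I G)] {D : E →L[ℝ] E →L[ℝ] E}
    (hD : HasFDerivAt (fun a => chartAd I ((extChartAt I (1 : G)).symm a)) D
      (extChartAt I (1 : G) 1))
    (hbr : ∀ v w : E, D v w = @Bracket.bracket (GroupLieAlgebra I G) (GroupLieAlgebra I G) _ v w) :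
    ∀ᶠ g in 𝓝 (1 : G), traceForm D (chartAd I g) = 0 → g = 1 := by
  have h1 := (traceForm D).hasFDerivAt.comp (extChartAt I (1 : G) 1) hD
  have hinj : LinearMap.ker ((traceForm D).comp D).toLinearMap = ⊥ := by
    rw [LinearMap.ker_eq_bot']
    intro z hz
    have h2 : D z = 0 := eq_zero_of_trace_comp_self_eq_zero I hD (DFunLike.congr_fun hz z)
    have h3 : (show GroupLieAlgebra I G from z) ∈
        LieAlgebra.center ℝ (GroupLieAlgebra I G) := by
      rw [LieModule.mem_maxTrivSubmodule]
      intro w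
      rw [← lie_skew]
      have h4 := hbr z w
      rw [h2] at h4
      refine neg_eq_zero.2 h4.symm
    rw [LieAlgebra.center_eq_bot] at h3
    exact h3
  obtain ⟨K, -, hK⟩ := LinearMap.exists_antilipschitzWith _ hinj
  have h2 := h1.eventually_ne ⟨K, hK⟩ (c := 0)
  rw [eventually_nhdsWithin_iff] at h2
  filter_upwards [(continuousAt_extChartAt (I := I) (1 : G)).eventually h2,
    eventually_extChartAt_left_inv I (G := G)] with g hg hg' h
  by_contra hne
  refine hg (fun h' => hne ?_) ?_
  · rw [← hg', show extChartAt I (1 : G) g = extChartAt I (1 : G) 1 from h', extChartAt_to_inv]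
  · simpa only [Function.comp_apply, hg'] using h

end LieTracking
end

theorem mainTheorem9
    {E : Type*} [NormedAddCommGroup E] [NormedSpace ℝ E] [FiniteDimensional ℝ E]
    {H : Type*} [TopologicalSpace H] (I : ModelWithCorners ℝ E H) [I.Boundaryless]
    {G : Type*} [TopologicalSpace G] [ChartedSpace H G] [Group G] [LieGroup I ∞ G]
    [T2Space G] [CompactSpace G] [ConnectedSpace G]
    {m : ℕ} (X : Fin m → GroupLieAlgebra I G)
    (hX : LieSubalgebra.lieSpan ℝ (GroupLieAlgebra I G) (Set.range X) = ⊤)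
    (xr : ℝ → G) (ur : Fin m → ℝ → ℝ) (T : ℝ)
    (hper : LieTracking.IsPeriodicTrajectory I X xr ur T)
    (hreg : LieTracking.IsRegularTrajectory I X xr) :
    (∀ x y : G, x ∈ LieTracking.criticalSet I X xr →
      y * x * y⁻¹ ∈ LieTracking.criticalSet I X xr) ∧
    (∀ x y : G, x * y ∈ LieTracking.criticalSet I X xr →
      y * x ∈ LieTracking.criticalSet I X xr) ∧
    (∀ x : G, x ∈ LieTracking.criticalSet I X xr →
      x⁻¹ ∈ LieTracking.criticalSet I X xr) ∧
    (LieAlgebra.HasTrivialRadical ℝ (GroupLieAlgebra I G) →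
      (∃ K : Subgroup G, (K : Set G) = LieTracking.criticalSet I X xr) →
      (LieTracking.criticalSet I X xr).Finite) := by
  obtain ⟨D, hD, hbr⟩ := LieTracking.exists_hasFDerivAt_chartAd I (G := G)
  have hmem := LieTracking.mem_criticalSet_iff I hD hreg
  have hconj : ∀ x y : G, x ∈ LieTracking.criticalSet I X xr →
      y * x * y⁻¹ ∈ LieTracking.criticalSet I X xr := fun x y hx => by
    rw [hmem] at hx ⊢
    exact LieTracking.traceForm_conj_eq_zero I hD y hx
  refine ⟨hconj, fun x y hxy => ?_, fun x hx => ?_, ?_⟩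
  · simpa [mul_assoc] using hconj _ y hxy
  · rw [hmem] at hx ⊢
    exact LieTracking.traceForm_inv_eq_zero I hD hx
  · rintro hrad ⟨K, hK⟩
    rw [← hK]
    have := topologicalGroup_of_lieGroup I ∞ (G := G)
    have hev := LieTracking.eventually_traceForm_chartAd_ne_zero I hD hbr
    have hopen : IsOpen ({1} : Set K) := by
      rw [isOpen_singleton_iff_nhds_eq_pure]
      refine le_antisymm (Filter.le_pure_iff.2 ?_) (pure_le_nhds 1)
      have h1 : Filter.Tendsto (fun k : K => (k : G)) (nhds 1) (nhds 1) :=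
        continuous_subtype_val.tendsto (1 : K)
      filter_upwards [h1.eventually hev] with k hk
      exact Subtype.ext (hk ((hmem k).1 (hK ▸ k.2)))
    have : DiscreteTopology K := discreteTopology_of_isOpen_singleton_one hopen
    have hcl : IsClosed (K : Set G) := Subgroup.isClosed_of_discrete
    have : CompactSpace K := isCompact_iff_compactSpace.1 hcl.isCompact
    have : Finite K := finite_of_compact_of_discrete
    exact Set.toFinite _
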